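/- Let $f$ be a real-valued function on the positive integers with $f(N)\to\infty$ as $N\to\infty$. Then there is a set $A$ of positive integers of natural density zero (depending on $f$), i.e. $\#\{n\le x : n\in A\}/x\to 0$ as $x\to\infty$, such that $$\gcd(N,\sigma(N))\le(\log\log N)^{f(N)}$$ for every integer $N\ge 3$ with $N\notin A$, where $\sigma(N)$ is the sum of the divisors of $N$. More generally, the same conclusion holds, with a set $A$ depending on $f$ and $s$, when $\sigma$ is replaced by any multiplicative function $s$ from the positive integers to the positive integers such that $s(p)=p+1$ for every prime $p$ and such that, for some constant $C$, $s(p^e)<p^{Ce}$ for all primes $p$ and all integers $e\ge 1$. -/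

import Mathlib

open Filter Topology
open scoped ArithmeticFunction.sigma

/-- A set `A` of natural numbers has (natural) density zero: the proportion of the integers
`1 ≤ n ≤ x` that lie in `A` tends to zero as `x` tends to infinity. -/
def HasDensityZero (A : Set ℕ) : Prop :=
  Tendsto (fun x : ℕ => ({n : ℕ | 1 ≤ n ∧ n ≤ x ∧ n ∈ A}.ncard : ℝ) / (x : ℝ)) atTop (𝓝 0)

/-- The inequality `gcd (N, s N) ≤ (log log N) ^ f N` holds for all positive integers `N` outside
some set of density zero. The restriction `3 ≤ N` says that `log log N` is defined and positive. -/
def GcdBoundOutsideDensityZero (f : ℕ → ℝ) (s : ArithmeticFunction ℕ) : Prop :=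
  ∃ A : Set ℕ, HasDensityZero A ∧
    ∀ N : ℕ, 3 ≤ N → N ∉ A →
      (Nat.gcd N (s N) : ℝ) ≤ (Real.log (Real.log (N : ℝ))) ^ (f N)

/-! Fix a large `x` and put `L = log log x`, with `Z` about `L ^ 4`. A prime `p` dividing `gcd (N, s
N)` divides `s (q ^ e)` for some prime power `q ^ e` exactly dividing `N`. If `e ≥ 2` and `N` has no
divisor `d ^ 2` with `d > D`, then `q ^ e ≤ D ^ 3`, so `p` is bounded in terms of `C` and `D`
(`le_of_prime_dvd_gcd`). If `e = 1`, then `q ≡ -1` modulo `p`. The number of `N ≤ x` with such a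
pair and `p > Z` is at most `x ∑ 1 / (p q)`. An elementary substitute for Brun–Titchmarsh bounds the
inner sum over `q` by `O(L log p / p)`; the extra `log p` is harmless, and the total is `O(x L / √Z)
= O(x / L)` (`card_hasLargeNegOnePair_le`).

So for most `N` the gcd is `Z`-smooth, hence at most the `Z`-smooth part of `N`. The logarithm of
that part averages `O(log Z) = O(log L)`, so by Markov it rarely exceeds a large multiple of `log
L`, and `f → ∞` supplies the multiple. -/

/-! ### The smooth part of an integer on average -/

/-- The logarithm of the `Z`-smooth part of `N`. -/
noncomputable def logSmoothPart (Z N : ℕ) : ℝ :=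
  ∑ p ∈ Nat.primesLE Z, (N.factorization p : ℝ) * Real.log p

theorem logSmoothPart_nonneg (Z N : ℕ) : 0 ≤ logSmoothPart Z N :=
  Finset.sum_nonneg fun p _ => mul_nonneg (Nat.cast_nonneg _) (Real.log_natCast_nonneg p)

theorem log_le_logSmoothPart {Z N g : ℕ} (hN : N ≠ 0) (hg : g ∣ N)
    (h : ∀ p, p.Prime → p ∣ g → p ≤ Z) : Real.log g ≤ logSmoothPart Z N := by
  have hg0 : g ≠ 0 := ne_zero_of_dvd_ne_zero hN hg
  have hlog : Real.log g = ∑ p ∈ g.primeFactors, (g.factorization p : ℝ) * Real.log p := by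
    conv_lhs => rw [← Nat.prod_factorization_pow_eq_self hg0]
    rw [Finsupp.prod, Nat.cast_prod, Real.log_prod]
    · simp [Nat.support_factorization]
    · intro p hp
      have := (Nat.prime_of_mem_primeFactors hp).pos
      positivity
  rw [hlog, logSmoothPart]
  calc _ ≤ ∑ p ∈ g.primeFactors, (N.factorization p : ℝ) * Real.log p := by
        refine Finset.sum_le_sum fun p _ => ?_
        have := (Nat.factorization_le_iff_dvd hg0 hN).2 hg p
        have := Real.log_natCast_nonneg p
        gcongr
    _ ≤ _ := by
        refine Finset.sum_le_sum_of_subset_of_nonneg (fun p hp => ?_) fun p _ _ =>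
          mul_nonneg (Nat.cast_nonneg _) (Real.log_natCast_nonneg p)
        have hp' := Nat.prime_of_mem_primeFactors hp
        exact Nat.mem_primesLE.2 ⟨h p hp' (Nat.dvd_of_mem_primeFactors hp), hp'⟩

theorem sum_factorization_Icc (p x : ℕ) :
    ∑ N ∈ Finset.Icc 1 x, N.factorization p = x.factorial.factorization p := by
  rw [← Finset.prod_Ico_id_eq_factorial, Finset.Ico_add_one_right_eq_Icc, Nat.factorization_prod fun i hi =>
    (Nat.one_le_iff_ne_zero.1 (Finset.mem_Icc.1 hi).1)]
  simp

/-- The upper half of Mertens' first theorem: compare `log Z! ≤ Z log Z` with the exponents of `Z!`,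
each at least `Z / p - 1`. Chebyshev's bound on `θ(Z)` pays for the `-1`. -/
theorem sum_primesLE_log_div_le {Z : ℕ} (hZ : 0 < Z) :
    ∑ p ∈ Nat.primesLE Z, Real.log p / p ≤ Real.log Z + Real.log 4 := by
  have hZ' : (0 : ℝ) < Z := by exact_mod_cast hZ
  have htheta := Chebyshev.theta_le_log4_mul_x hZ'.le
  rw [Chebyshev.theta_eq_sum_primesLE_log] at htheta
  have hfac : ∑ p ∈ Nat.primesLE Z, (Z.factorial.factorization p : ℝ) * Real.log p
      ≤ Z * Real.log Z := by
    have h1 : Real.log Z.factorial ≤ Z * Real.log Z := by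
      rw [← Real.log_pow]
      refine Real.log_le_log (by exact_mod_cast Z.factorial_pos) ?_
      exact_mod_cast Nat.factorial_le_pow Z
    refine le_trans (le_of_eq ?_) h1
    conv_rhs => rw [← Nat.prod_factorization_pow_eq_self Z.factorial_ne_zero]
    rw [Finsupp.prod, Nat.cast_prod, Real.log_prod]
    · simp only [Nat.cast_pow, Real.log_pow, Nat.support_factorization]
      refine (Finset.sum_subset (fun p hp => ?_) fun p _ hp => ?_).symm
      · have hp' := Nat.prime_of_mem_primeFactors hp
        exact Nat.mem_primesLE.2
          ⟨hp'.dvd_factorial.1 (Nat.dvd_of_mem_primeFactors hp), hp'⟩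
      · rw [← Nat.support_factorization, Finsupp.notMem_support_iff] at hp
        simp [hp]
    · intro p hp
      have := (Nat.prime_of_mem_primeFactors hp).pos
      positivity
  have hterm : ∀ p ∈ Nat.primesLE Z, Z * (Real.log p / p) ≤
      (Z.factorial.factorization p : ℝ) * Real.log p + Real.log p := by
    intro p hp
    obtain ⟨hpZ, hp⟩ := Nat.mem_primesLE.1 hp
    have hv : Z / p ≤ Z.factorial.factorization p := by
      rw [← hp.pow_dvd_iff_le_factorization Z.factorial_ne_zero]
      calc p ^ (Z / p) ∣ (p * (Z / p)).factorial :=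
            (hp.pow_dvd_factorial_iff (Nat.lt_succ_self _)).2 (by
              rw [← Nat.factorization_factorial hp (Nat.lt_succ_self _),
                Nat.factorization_factorial_mul hp]
              omega)
        _ ∣ Z.factorial := Nat.factorial_dvd_factorial (Nat.mul_div_le Z p)
    have h2 : (Z : ℝ) / p ≤ Z.factorial.factorization p + 1 := by
      have h3 := Nat.lt_floor_add_one ((Z : ℝ) / p)
      rw [Nat.floor_div_eq_div] at h3
      have : ((Z / p : ℕ) : ℝ) ≤ Z.factorial.factorization p := by exact_mod_cast hv
      linarith
    have := mul_le_mul_of_nonneg_right h2 (Real.log_natCast_nonneg p)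
    calc _ = (Z : ℝ) / p * Real.log p := by ring
      _ ≤ _ := this
      _ = _ := by ring
  have hsum := Finset.sum_le_sum hterm
  rw [← Finset.mul_sum, Finset.sum_add_distrib] at hsum
  refine le_of_mul_le_mul_left ?_ hZ'
  linarith

theorem sum_logSmoothPart_le {Z : ℕ} (hZ : 0 < Z) (x : ℕ) :
    ∑ N ∈ Finset.Icc 1 x, logSmoothPart Z N ≤ x * (2 * (Real.log Z + Real.log 4)) := by
  unfold logSmoothPart
  rw [Finset.sum_comm]
  calc _ ≤ ∑ p ∈ Nat.primesLE Z, x * (2 * (Real.log p / p)) := by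
        refine Finset.sum_le_sum fun p hp => ?_
        obtain ⟨-, hp⟩ := Nat.mem_primesLE.1 hp
        rw [← Finset.sum_mul, ← Nat.cast_sum, sum_factorization_Icc]
        have h1 : (x.factorial.factorization p : ℝ) ≤ x / ((p - 1 : ℕ) : ℝ) :=
          (Nat.cast_le.2 (Nat.factorization_factorial_le_div_pred hp x)).trans Nat.cast_div_le
        have hp2 : (2 : ℝ) ≤ p := by exact_mod_cast hp.two_le
        have h2 : (x : ℝ) / ((p - 1 : ℕ) : ℝ) ≤ x * (2 / p) := by
          rw [Nat.cast_sub hp.one_le, Nat.cast_one, div_le_iff₀ (by linarith)]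
          have : (1 : ℝ) ≤ 2 / p * (p - 1) := by
            rw [div_mul_eq_mul_div, le_div_iff₀ (by linarith)]
            linarith
          calc (x : ℝ) = x * 1 := (mul_one _).symm
            _ ≤ x * (2 / p * (p - 1)) := by gcongr
            _ = _ := by ring
        calc _ ≤ (x * (2 / p)) * Real.log p :=
              mul_le_mul_of_nonneg_right (h1.trans h2) (Real.log_natCast_nonneg p)
          _ = _ := by ring
    _ = x * (2 * ∑ p ∈ Nat.primesLE Z, Real.log p / p) := by
        rw [← Finset.mul_sum, ← Finset.mul_sum]
    _ ≤ _ := by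
        have := sum_primesLE_log_div_le hZ
        gcongr

theorem card_lt_logSmoothPart_le {Z : ℕ} (hZ : 0 < Z) (x : ℕ) {t : ℝ} (ht : 0 < t) :
    (((Finset.Icc 1 x).filter fun N => t < logSmoothPart Z N).card : ℝ)
      ≤ x * (2 * (Real.log Z + Real.log 4)) / t := by
  rw [le_div_iff₀ ht, ← nsmul_eq_mul]
  refine (Finset.card_nsmul_le_sum _ (logSmoothPart Z) t fun N hN =>
    (Finset.mem_filter.1 hN).2.le).trans ?_
  exact (Finset.sum_le_sum_of_subset_of_nonneg (Finset.filter_subset _ _) fun N _ _ =>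
    logSmoothPart_nonneg Z N).trans (sum_logSmoothPart_le hZ x)

/-! ### Primes congruent to `-1` modulo `p` -/

/-- The primes `q ≡ -1` modulo `p` with `pK < q + 1 ≤ 2pK`, indexed by `(q + 1) / p`. -/
def negOnePrimeBlock (p K : ℕ) : Finset ℕ :=
  (Finset.Ioc K (2 * K)).filter fun k => (p * k - 1).Prime

/-- With `u` an inverse of `p` modulo `m`, `u (p (k + 1) - 1) ≡ (1 - u) + k`. Up to a unit the
product is one of `K` consecutive integers, hence divisible by `K!`. -/
theorem dvd_prod_neg_one_progression {m p K : ℕ} (hm : m ∣ K.factorial)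
    (hmp : m.Coprime p) : m ∣ ∏ k ∈ Finset.range K, (p * (k + 1) - 1) := by
  rcases Nat.eq_zero_or_pos p with rfl | hp
  · have : m = 1 := by simpa using hmp
    simp [this]
  obtain ⟨u, v, huv⟩ := (Nat.isCoprime_iff_coprime.2 hmp.symm)
  have hu : IsCoprime (m : ℤ) u := ⟨v, p, by linarith⟩
  have key : (m : ℤ) ∣ u ^ K * ∏ k ∈ Finset.range K, ((p : ℤ) * (k + 1) - 1) := by
    have h1 : (m : ℤ) ∣ ∏ i ∈ Finset.range K, ((1 - u) + (i : ℤ)) :=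
      (Int.natCast_dvd_natCast.2 hm).trans (Nat.factorial_coe_dvd_prod K (1 - u))
    rw [← Int.modEq_zero_iff_dvd] at h1 ⊢
    refine Int.ModEq.trans ?_ h1
    have : u ^ K * ∏ k ∈ Finset.range K, ((p : ℤ) * (k + 1) - 1) =
        ∏ k ∈ Finset.range K, (u * ((p : ℤ) * (k + 1) - 1)) := by
      rw [Finset.prod_mul_distrib]; simp
    rw [this]
    refine Int.ModEq.prod fun k _ => ?_
    rw [Int.modEq_iff_dvd]
    refine ⟨v * (k + 1), ?_⟩
    linear_combination (k + 1 : ℤ) * (-huv)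
  have h2 := (hu.pow_right (n := K)).dvd_of_dvd_mul_left key
  rw [← Int.natCast_dvd_natCast]
  suffices h3 : ((∏ k ∈ Finset.range K, (p * (k + 1) - 1) : ℕ) : ℤ) =
      ∏ k ∈ Finset.range K, ((p : ℤ) * (k + 1) - 1) by rwa [h3]
  rw [Nat.cast_prod]
  refine Finset.prod_congr rfl fun k _ => ?_
  rw [Nat.cast_sub (Nat.mul_pos hp k.succ_pos)]
  push_cast
  ring

/-- A Chebyshev-type argument. The product `P` of all `p k - 1` with `k ≤ 2K` is divisible by the
prime-to-`p` part `m` of `(2K)!` and by the product `Q` of the primes in the block. These primes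
exceed `2K`, so `m Q ∣ P`, while `P ≤ p ^ (2K) (2K)!`; cancelling `m` leaves only powers of `p`. -/
theorem prod_negOnePrimeBlock_le {p K : ℕ} (hp : p.Prime) (hp3 : 3 ≤ p) (hK : 0 < K) :
    ∏ k ∈ negOnePrimeBlock p K, (p * k - 1) ≤ p ^ (4 * K) := by
  set F := (2 * K).factorial with hF
  have hF0 : F ≠ 0 := Nat.factorial_ne_zero _
  set a := F.factorization p with ha
  set m := F / p ^ a with hm
  have hFm : p ^ a * m = F := Nat.ordProj_mul_ordCompl_eq_self F p
  set Q := ∏ k ∈ negOnePrimeBlock p K, (p * k - 1) with hQ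
  set P := ∏ k ∈ Finset.range (2 * K), (p * (k + 1) - 1) with hP
  have hmp : m.Coprime p := (Nat.coprime_ordCompl hp hF0).symm
  have hmP : m ∣ P :=
    dvd_prod_neg_one_progression (Dvd.intro_left _ hFm) hmp
  have hQP : Q ∣ P := by
    have h1 : P = ∏ k ∈ Finset.Ioc 0 (2 * K), (p * k - 1) := by
      rw [hP, Finset.range_eq_Ico, Finset.prod_Ico_add' (fun k => p * k - 1)]
      rfl
    rw [h1]
    refine Finset.prod_dvd_prod_of_subset _ _ _ fun k hk => ?_
    have := Finset.mem_Ioc.1 (Finset.mem_filter.1 hk).1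
    exact Finset.mem_Ioc.2 ⟨by omega, this.2⟩
  have hQm : m.Coprime Q := by
    refine Nat.Coprime.prod_right fun k hk => ?_
    obtain ⟨hk1, hkp⟩ := Finset.mem_filter.1 hk
    have hk1 := (Finset.mem_Ioc.1 hk1).1
    refine Nat.Coprime.symm ((Nat.Prime.coprime_iff_not_dvd hkp).2 fun hd => ?_)
    have hd' : p * k - 1 ∣ F := hd.trans (Dvd.intro_left _ hFm)
    have := hkp.dvd_factorial.1 hd'
    have : 3 * (K + 1) ≤ p * k := Nat.mul_le_mul hp3 hk1
    omega
  have hP0 : 0 < P := Finset.prod_pos fun k _ => by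
    have : 3 * 1 ≤ p * (k + 1) := Nat.mul_le_mul hp3 (by omega)
    omega
  have hmQ : m * Q ≤ P := Nat.le_of_dvd hP0 (hQm.mul_dvd_of_dvd_of_dvd hmP hQP)
  have hPle : P ≤ p ^ (2 * K) * F := by
    have : p ^ (2 * K) * F = ∏ k ∈ Finset.range (2 * K), (p * (k + 1)) := by
      rw [Finset.prod_mul_distrib, Finset.prod_range_add_one_eq_factorial]; simp [hF]
    rw [this]
    exact Finset.prod_le_prod' fun k _ => Nat.sub_le _ _
  have haK : a ≤ 2 * K := (Nat.factorization_factorial_le_div_pred hp _).trans (Nat.div_le_self _ _)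
  have hm0 : 0 < m := Nat.pos_of_ne_zero fun h => hF0 (by rw [← hFm, h, mul_zero])
  refine Nat.le_of_mul_le_mul_left ?_ hm0
  calc m * Q ≤ p ^ (2 * K) * (p ^ a * m) := by rw [hFm]; exact hmQ.trans hPle
    _ ≤ p ^ (2 * K) * (p ^ (2 * K) * m) := by gcongr; exact hp.one_le
    _ = m * p ^ (4 * K) := by rw [show 4 * K = 2 * K + 2 * K by ring, pow_add]; ring

theorem sum_negOnePrimeBlock_inv_le {p : ℕ} (hp : p.Prime) (hp3 : 3 ≤ p) (j : ℕ) :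
    ∑ k ∈ negOnePrimeBlock p (2 ^ j), (1 : ℝ) / ((p * k - 1 : ℕ) : ℝ)
      ≤ 4 / Real.log 2 * (Real.log p / p) * (1 / (j + 1)) := by
  set K := 2 ^ j with hKdef
  have hK : 0 < K := by positivity
  have hp0 : (0 : ℝ) < p := by exact_mod_cast hp.pos
  have hlog2 : 0 < Real.log 2 := Real.log_pos (by norm_num)
  have hge : ∀ k ∈ negOnePrimeBlock p K, ((p * K : ℕ) : ℝ) ≤ ((p * k - 1 : ℕ) : ℝ) := by
    intro k hk
    have hk1 := (Finset.mem_Ioc.1 (Finset.mem_filter.1 hk).1).1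
    have : p * (K + 1) ≤ p * k := Nat.mul_le_mul_left _ hk1
    rw [mul_add] at this
    exact_mod_cast (by omega : p * K ≤ p * k - 1)
  have hpK : (0 : ℝ) < ((p * K : ℕ) : ℝ) := by exact_mod_cast Nat.mul_pos hp.pos hK
  -- Each prime of the block is at least `p K ≥ 2 ^ (j + 1)`, so the bound on their product limits
  -- their number.
  have hcard : ((negOnePrimeBlock p K).card : ℝ) * ((j + 1) * Real.log 2) ≤ 4 * K * Real.log p := by
    have h1 : ((p * K : ℕ) : ℝ) ^ (negOnePrimeBlock p K).card ≤ (p : ℝ) ^ (4 * K) := by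
      rw [← Finset.prod_const]
      calc _ ≤ ∏ k ∈ negOnePrimeBlock p K, ((p * k - 1 : ℕ) : ℝ) :=
            Finset.prod_le_prod (fun _ _ => hpK.le) hge
        _ ≤ _ := by exact_mod_cast prod_negOnePrimeBlock_le hp hp3 hK
    have h2 := Real.log_le_log (by positivity) h1
    rw [Real.log_pow, Real.log_pow] at h2
    push_cast at h2
    refine le_trans ?_ h2
    gcongr
    rw [Real.log_mul hp0.ne' (by positivity), hKdef]
    push_cast
    rw [Real.log_pow]
    have : Real.log 2 ≤ Real.log p :=
      Real.log_le_log (by norm_num) (by exact_mod_cast hp.two_le)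
    linarith
  calc _ ≤ ∑ _k ∈ negOnePrimeBlock p K, (1 : ℝ) / ((p * K : ℕ) : ℝ) :=
        Finset.sum_le_sum fun k hk => one_div_le_one_div_of_le hpK (hge k hk)
    _ = (negOnePrimeBlock p K).card * (1 / ((p * K : ℕ) : ℝ)) := by
        rw [Finset.sum_const, nsmul_eq_mul]
    _ ≤ (4 * K * Real.log p / ((j + 1) * Real.log 2)) * (1 / ((p * K : ℕ) : ℝ)) := by
        gcongr
        rwa [le_div_iff₀ (by positivity)]
    _ = _ := by
        have hK' : (K : ℝ) ≠ 0 := by exact_mod_cast hK.ne'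
        push_cast
        field_simp

/-- A weak form of the Brun–Titchmarsh bound for the reciprocals of the primes
congruent to `-1` modulo `p`. -/
theorem sum_inv_primes_neg_one_mod_le {p : ℕ} (hp : p.Prime) (hp5 : 5 ≤ p) (J : ℕ) :
    ∑ k ∈ (Finset.Icc 1 (2 ^ J)).filter (fun k => (p * k - 1).Prime),
      (1 : ℝ) / ((p * k - 1 : ℕ) : ℝ)
      ≤ 4 / Real.log 2 * (Real.log p / p) * (1 + Real.log J) := by
  have hdyadic : ∀ J : ℕ, ∑ k ∈ (Finset.Icc 1 (2 ^ J)).filter (fun k => (p * k - 1).Prime),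
      (1 : ℝ) / ((p * k - 1 : ℕ) : ℝ) = ∑ j ∈ Finset.range J,
        ∑ k ∈ negOnePrimeBlock p (2 ^ j), (1 : ℝ) / ((p * k - 1 : ℕ) : ℝ) := by
    intro J
    induction J with
    | zero =>
      -- The dyadic blocks miss `k = 1`; for `p ≥ 5` the number `p - 1` is even and larger than `2`.
      have : ¬ (p - 1).Prime := fun h => by
        have h1 := hp.eq_two_or_odd
        have h2 := h.eq_two_or_odd
        omega
      simp [Finset.filter_singleton, this]
    | succ J ih =>
      have hpos : 0 < 2 ^ J := by positivity
      rw [Finset.sum_range_succ, ← ih, negOnePrimeBlock, ← Finset.sum_union, ← Finset.filter_union]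
      · congr 2
        ext k
        simp only [Finset.mem_union, Finset.mem_Icc, Finset.mem_Ioc, pow_succ']
        omega
      · refine Finset.disjoint_filter_filter (Finset.disjoint_left.2 fun k h1 h2 => ?_)
        simp only [Finset.mem_Icc, Finset.mem_Ioc] at h1 h2
        omega
  have hlog2 : 0 < Real.log 2 := Real.log_pos (by norm_num)
  rw [hdyadic]
  calc _ ≤ ∑ j ∈ Finset.range J, 4 / Real.log 2 * (Real.log p / p) * (1 / (j + 1)) :=
        Finset.sum_le_sum fun j _ => sum_negOnePrimeBlock_inv_le hp (by omega) j
    _ ≤ _ := by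
        rw [← Finset.mul_sum]
        have h := harmonic_le_one_add_log J
        rw [harmonic] at h
        push_cast at h
        have := Real.log_natCast_nonneg p
        simp only [one_div]
        gcongr

/-! ### Counting integers with large square divisors or large pairs -/

/-- A telescoping majorant, from `log (n + 1) ≤ 2 √(n + 1)` and `1/a - 1/b = 1/(a b (a + b))` when
`b ^ 2 - a ^ 2 = 1`. -/
theorem log_div_sq_le_sub {n : ℕ} (hn : 0 < n) :
    Real.log (n + 1 : ℕ) / ((n + 1 : ℕ) : ℝ) ^ 2 ≤ 4 * (1 / √n - 1 / √(n + 1 : ℕ)) := by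
  have hn' : (0 : ℝ) < n := by exact_mod_cast hn
  push_cast
  set a := √(n : ℝ) with ha
  set b := √((n : ℝ) + 1) with hb
  have ha0 : 0 < a := Real.sqrt_pos.2 hn'
  have hab : a ≤ b := Real.sqrt_le_sqrt (by linarith)
  have hb0 : 0 < b := ha0.trans_le hab
  have ha2 : a ^ 2 = n := Real.sq_sqrt hn'.le
  have hb2 : b ^ 2 = n + 1 := Real.sq_sqrt (by linarith)
  have hlog : Real.log ((n : ℝ) + 1) ≤ 2 * b := by
    rw [← hb2, Real.log_pow]
    have := Real.log_le_sub_one_of_pos hb0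
    push_cast
    linarith
  rw [← hb2] at hlog ⊢
  calc _ ≤ 2 * b / (b ^ 2) ^ 2 := by gcongr
    _ = 4 * (1 / (b * b * (2 * b))) := by field_simp; norm_num
    _ ≤ 4 * (1 / (a * b * (a + b))) := by gcongr; linarith
    _ = 4 * ((b ^ 2 - a ^ 2) / (a * b * (a + b))) := by rw [ha2, hb2]; ring
    _ = _ := by field_simp; ring

theorem sum_Ioc_log_div_sq_le {Z x : ℕ} (hZ : 0 < Z) :
    ∑ n ∈ Finset.Ioc Z x, Real.log n / (n : ℝ) ^ 2 ≤ 4 / √Z := by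
  rcases le_total x Z with h | h
  · rw [Finset.Ioc_eq_empty_of_le h, Finset.sum_empty]
    positivity
  have hstep : ∑ n ∈ Finset.Ioc Z x, Real.log n / (n : ℝ) ^ 2 ≤ 4 * (1 / √Z - 1 / √x) := by
    induction x, h using Nat.le_induction with
    | base => simp
    | succ n hn ih =>
      rw [Finset.sum_Ioc_succ_top (by omega)]
      have := log_div_sq_le_sub (n := n) (by omega)
      linarith
  refine hstep.trans ?_
  have : 0 ≤ 1 / √(x : ℝ) := by positivity
  calc _ ≤ 4 * (1 / √(Z : ℝ)) := by linarith
    _ = _ := by ring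

theorem card_filter_dvd_le (x d : ℕ) :
    (((Finset.Icc 1 x).filter (d ∣ ·)).card : ℝ) ≤ x / d := by
  have h : ((Finset.Icc 1 x).filter (d ∣ ·)).card = x / d := Nat.Ioc_filter_dvd_card_eq_div x d
  rw [h]
  exact Nat.cast_div_le

open Classical in
theorem card_sq_dvd_le {D : ℕ} (hD : 0 < D) (x : ℕ) :
    (((Finset.Icc 1 x).filter fun N => ∃ d, D < d ∧ d ^ 2 ∣ N).card : ℝ) ≤ x * (2 / D) := by
  have hsub : ((Finset.Icc 1 x).filter fun N => ∃ d, D < d ∧ d ^ 2 ∣ N) ⊆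
      (Finset.Ioo D (x + 1)).biUnion fun d => (Finset.Icc 1 x).filter (d ^ 2 ∣ ·) := by
    intro N hN
    obtain ⟨hN, d, hDd, hd⟩ := Finset.mem_filter.1 hN
    refine Finset.mem_biUnion.2 ⟨d, Finset.mem_Ioo.2 ⟨hDd, ?_⟩, Finset.mem_filter.2 ⟨hN, hd⟩⟩
    obtain ⟨h1, h2⟩ := Finset.mem_Icc.1 hN
    have := Nat.le_of_dvd h1 ((dvd_pow_self d two_ne_zero).trans hd)
    omega
  have hD' : (0 : ℝ) < D := by exact_mod_cast hD
  calc _ ≤ (((Finset.Ioo D (x + 1)).biUnion fun d =>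
        (Finset.Icc 1 x).filter (d ^ 2 ∣ ·)).card : ℝ) := by
        exact_mod_cast Finset.card_le_card hsub
    _ ≤ ∑ d ∈ Finset.Ioo D (x + 1), (((Finset.Icc 1 x).filter (d ^ 2 ∣ ·)).card : ℝ) := by
        exact_mod_cast Finset.card_biUnion_le
    _ ≤ ∑ d ∈ Finset.Ioo D (x + 1), x * ((d : ℝ) ^ 2)⁻¹ :=
        Finset.sum_le_sum fun d _ => (card_filter_dvd_le x (d ^ 2)).trans_eq (by
          push_cast; rw [div_eq_mul_inv])
    _ ≤ x * (2 / (D + 1)) := by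
        rw [← Finset.mul_sum]
        exact mul_le_mul_of_nonneg_left (sum_Ioo_inv_sq_le D (x + 1)) (Nat.cast_nonneg x)
    _ ≤ _ := by gcongr; linarith

/-- `N` has prime factors `p > Z` and `q` with `q ≡ -1` modulo `p`. -/
def HasLargeNegOnePair (Z N : ℕ) : Prop :=
  ∃ p q, p.Prime ∧ Z < p ∧ p ∣ N ∧ q.Prime ∧ q ∣ N ∧ p ∣ q + 1

open Classical in
theorem card_hasLargeNegOnePair_le {Z x J : ℕ} (hZ : 4 ≤ Z) (hJ : x ≤ 2 ^ J) :
    (((Finset.Icc 1 x).filter (HasLargeNegOnePair Z)).card : ℝ)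
      ≤ x * (16 / Real.log 2 * (1 + Real.log J) / √Z) := by
  set A : ℕ → Finset ℕ := fun p => (Finset.Icc 1 (2 ^ J)).filter fun k => (p * k - 1).Prime
  set P := (Finset.Ioc Z x).filter Nat.Prime
  have hsub : (Finset.Icc 1 x).filter (HasLargeNegOnePair Z) ⊆ P.biUnion fun p =>
      (A p).biUnion fun k => (Finset.Icc 1 x).filter (p * (p * k - 1) ∣ ·) := by
    intro N hN
    obtain ⟨hN, p, q, hp, hZp, hpN, hq, hqN, k, hk⟩ := Finset.mem_filter.1 hN
    obtain ⟨h1, h2⟩ := Finset.mem_Icc.1 hN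
    have hpx := (Nat.le_of_dvd h1 hpN).trans h2
    have hqx := (Nat.le_of_dvd h1 hqN).trans h2
    have hk0 : k ≠ 0 := by rintro rfl; omega
    have hkq : p * k - 1 = q := by omega
    have hpk : 5 * k ≤ p * k := Nat.mul_le_mul_right _ (by omega)
    refine Finset.mem_biUnion.2 ⟨p, Finset.mem_filter.2 ⟨Finset.mem_Ioc.2 ⟨hZp, hpx⟩, hp⟩,
      Finset.mem_biUnion.2 ⟨k, Finset.mem_filter.2 ⟨Finset.mem_Icc.2 ⟨by omega, by omega⟩, ?_⟩,
      Finset.mem_filter.2 ⟨hN, ?_⟩⟩⟩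
    · rwa [hkq]
    · rw [hkq]
      refine Nat.Coprime.mul_dvd_of_dvd_of_dvd ((Nat.coprime_primes hp hq).2 ?_) hpN hqN
      rintro rfl
      have : p ∣ 1 := (Nat.dvd_add_right dvd_rfl).1 ⟨k, hk⟩
      exact hp.one_lt.ne' (Nat.dvd_one.1 this)
  have hlogJ : 0 ≤ 1 + Real.log J := by
    have := Real.log_natCast_nonneg J
    linarith
  have hlog2 : 0 < Real.log 2 := Real.log_pos (by norm_num)
  calc _ ≤ ((P.biUnion fun p => (A p).biUnion fun k =>
        (Finset.Icc 1 x).filter (p * (p * k - 1) ∣ ·)).card : ℝ) := by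
        exact_mod_cast Finset.card_le_card hsub
    _ ≤ ∑ p ∈ P, ∑ k ∈ A p, (((Finset.Icc 1 x).filter (p * (p * k - 1) ∣ ·)).card : ℝ) := by
        exact_mod_cast Finset.card_biUnion_le.trans
          (Finset.sum_le_sum fun p _ => Finset.card_biUnion_le)
    _ ≤ ∑ p ∈ P, ∑ k ∈ A p, (x / p : ℝ) * (1 / ((p * k - 1 : ℕ) : ℝ)) :=
        Finset.sum_le_sum fun p _ => Finset.sum_le_sum fun k _ =>
          (card_filter_dvd_le x _).trans_eq (by rw [Nat.cast_mul, div_mul_div_comm, mul_one])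
    _ ≤ ∑ p ∈ P, (x / p : ℝ) * (4 / Real.log 2 * (Real.log p / p) * (1 + Real.log J)) := by
        refine Finset.sum_le_sum fun p hp => ?_
        obtain ⟨hp1, hp⟩ := Finset.mem_filter.1 hp
        rw [← Finset.mul_sum]
        have := (Finset.mem_Ioc.1 hp1).1
        exact mul_le_mul_of_nonneg_left (sum_inv_primes_neg_one_mod_le hp (by omega) J)
          (by positivity)
    _ = x * (4 / Real.log 2 * (1 + Real.log J)) * ∑ p ∈ P, Real.log p / (p : ℝ) ^ 2 := by
        rw [Finset.mul_sum]
        refine Finset.sum_congr rfl fun p _ => ?_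
        ring
    _ ≤ x * (4 / Real.log 2 * (1 + Real.log J)) * (4 / √Z) := by
        gcongr
        refine (Finset.sum_le_sum_of_subset_of_nonneg (Finset.filter_subset _ _) fun n _ _ =>
          div_nonneg (Real.log_natCast_nonneg n) (by positivity)).trans
          (sum_Ioc_log_div_sq_le (by omega))
    _ = _ := by ring

/-! ### Prime factors of the gcd -/

theorem le_of_prime_dvd_gcd {s : ArithmeticFunction ℕ} (hs : s.IsMultiplicative)
    (hpos : ∀ n, 0 < n → 0 < s n) (hprime : ∀ p : ℕ, p.Prime → s p = p + 1) {C : ℝ} (hC : 0 ≤ C)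
    (hpow : ∀ p e : ℕ, p.Prime → 1 ≤ e → (s (p ^ e) : ℝ) < (p : ℝ) ^ (C * (e : ℝ)))
    {Z D N p : ℕ} (hN : N ≠ 0) (hDZ : ((D : ℝ) ^ 3) ^ C ≤ Z)
    (hsq : ¬ ∃ d, D < d ∧ d ^ 2 ∣ N) (hpair : ¬ HasLargeNegOnePair Z N)
    (hp : p.Prime) (hpg : p ∣ Nat.gcd N (s N)) : p ≤ Z := by
  by_contra! hZp
  have hpN := hpg.trans (Nat.gcd_dvd_left _ _)
  have hps := hpg.trans (Nat.gcd_dvd_right _ _)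
  rw [hs.multiplicative_factorization s hN, Finsupp.prod, hp.prime.dvd_finsetProd_iff] at hps
  obtain ⟨q, hq, hpq⟩ := hps
  rw [Nat.support_factorization] at hq
  have hq' := Nat.prime_of_mem_primeFactors hq
  have hqN := Nat.dvd_of_mem_primeFactors hq
  set e := N.factorization q with he
  have he1 : 1 ≤ e := hq'.factorization_pos_of_dvd hN hqN
  rcases he1.eq_or_lt with he1 | he2
  · rw [← he1, pow_one, hprime q hq'] at hpq
    exact hpair ⟨p, q, hp, hZp, hpN, hq', hqN, hpq⟩
  · have hd : q ^ (e / 2) ≤ D := by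
      by_contra! h
      refine hsq ⟨_, h, ?_⟩
      rw [← pow_mul]
      exact (pow_dvd_pow q (Nat.div_mul_le_self e 2)).trans (Nat.ordProj_dvd N q)
    -- Since `e ≥ 2`, `e ≤ 3 ⌊e / 2⌋`.
    have hqe : q ^ e ≤ D ^ 3 := calc
      q ^ e ≤ q ^ (e / 2 * 3) := Nat.pow_le_pow_right hq'.pos (by omega)
      _ = (q ^ (e / 2)) ^ 3 := pow_mul _ _ _
      _ ≤ D ^ 3 := Nat.pow_le_pow_left hd 3
    have h1 : (p : ℝ) ≤ s (q ^ e) := by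
      exact_mod_cast Nat.le_of_dvd (hpos _ (pow_pos hq'.pos _)) hpq
    have h2 : (q : ℝ) ^ (C * (e : ℝ)) ≤ Z := by
      rw [mul_comm, Real.rpow_mul (Nat.cast_nonneg q), Real.rpow_natCast]
      refine le_trans ?_ hDZ
      exact Real.rpow_le_rpow (by positivity) (by exact_mod_cast hqe) hC
    have h3 : (Z : ℝ) < p := by exact_mod_cast hZp
    linarith [hpow q e hq' he2.le]

/-! ### Iterated logarithms and the density bound -/

theorem log_clog_two_le {x : ℕ} (hx : 3 ≤ x) :
    Real.log (Nat.clog 2 x) ≤ Real.log (Real.log x) + 2 := by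
  have hx' : (3 : ℝ) ≤ x := by exact_mod_cast hx
  have hlx : 1 ≤ Real.log x := by
    rw [Real.le_log_iff_exp_le (by linarith)]
    linarith [Real.exp_one_lt_d9]
  have hlog2 := Real.log_two_gt_d9
  have h0 : 0 < Nat.clog 2 x := Nat.clog_pos (by norm_num) (by omega)
  have h1 : 2 ^ (Nat.clog 2 x - 1) < x := Nat.pow_pred_clog_lt_self (by norm_num) (by omega)
  have h2 : ((Nat.clog 2 x - 1 : ℕ) : ℝ) * Real.log 2 ≤ Real.log x := by
    rw [← Real.log_pow]
    exact Real.log_le_log (by positivity) (by exact_mod_cast h1.le)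
  rw [Nat.cast_sub h0, Nat.cast_one] at h2
  have h3 : (Nat.clog 2 x : ℝ) ≤ 4 * Real.log x := by
    by_contra! h
    nlinarith
  calc _ ≤ Real.log (4 * Real.log x) := Real.log_le_log (by exact_mod_cast h0) h3
    _ = 2 * Real.log 2 + Real.log (Real.log x) := by
        rw [Real.log_mul (by norm_num) (by linarith), show (4 : ℝ) = 2 ^ 2 by norm_num,
          Real.log_pow]
        norm_num
    _ ≤ _ := by linarith [Real.log_two_lt_d9]

theorem log_log_sub_one_le_of_sqrt_lt {x N : ℕ} (hx : 3 ≤ x) (hN : Nat.sqrt x < N) :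
    Real.log (Real.log x) - 1 ≤ Real.log (Real.log N) := by
  have hx' : (3 : ℝ) ≤ x := by exact_mod_cast hx
  have hlx : 0 < Real.log x := Real.log_pos (by linarith)
  have h1 : x ≤ N ^ 2 := (Nat.sqrt_lt'.1 hN).le
  have h2 : Real.log x ≤ 2 * Real.log N := by
    have := Real.log_le_log (by linarith : (0 : ℝ) < x)
      (by exact_mod_cast h1 : (x : ℝ) ≤ (N : ℝ) ^ 2)
    rwa [Real.log_pow] at this
  have h3 := Real.log_le_log hlx h2
  rw [Real.log_mul (by norm_num) (by linarith)] at h3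
  linarith [Real.log_two_lt_d9]

theorem log_ceil_pow_four_add_log_four_le {L : ℝ} (hL : 2 ≤ L) :
    Real.log ((⌈L⌉₊ ^ 4 : ℕ) : ℝ) + Real.log 4 ≤ 10 * Real.log L := by
  have h1 : (⌈L⌉₊ : ℝ) ≤ 2 * L := by
    have := Nat.ceil_lt_add_one (by linarith : 0 ≤ L)
    linarith
  have h0 : (0 : ℝ) < ⌈L⌉₊ := lt_of_lt_of_le (by linarith) (Nat.le_ceil L)
  have h2 := Real.log_le_log h0 h1
  rw [Real.log_mul (by norm_num) (by linarith)] at h2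
  have h3 : Real.log 2 ≤ Real.log L := Real.log_le_log (by norm_num) hL
  rw [Nat.cast_pow, Real.log_pow, show (4 : ℝ) = 2 ^ 2 by norm_num, Real.log_pow]
  push_cast
  linarith

/-- Off the integers up to `√x`, those with a large square divisor, those with a large pair of
prime factors and those with a large smooth part, the gcd is small. -/
theorem gcd_le_rpow_of_regular {f : ℕ → ℝ} {s : ArithmeticFunction ℕ} (hs : s.IsMultiplicative)
    (hpos : ∀ n, 0 < n → 0 < s n) (hprime : ∀ p : ℕ, p.Prime → s p = p + 1) {C : ℝ} (hC : 0 ≤ C)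
    (hpow : ∀ p e : ℕ, p.Prime → 1 ≤ e → (s (p ^ e) : ℝ) < (p : ℝ) ^ (C * (e : ℝ)))
    {Z D N x : ℕ} {M : ℝ} (hM : 0 ≤ M) (hx : 3 ≤ x) (hL : 4 ≤ Real.log (Real.log x))
    (hN : Nat.sqrt x < N) (hf : M ≤ f N) (hDZ : ((D : ℝ) ^ 3) ^ C ≤ Z)
    (hsq : ¬ ∃ d, D < d ∧ d ^ 2 ∣ N) (hpair : ¬ HasLargeNegOnePair Z N)
    (hsmooth : logSmoothPart Z N ≤ M / 2 * Real.log (Real.log (Real.log x))) :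
    (Nat.gcd N (s N) : ℝ) ≤ Real.log (Real.log N) ^ f N := by
  have hN0 : N ≠ 0 := by omega
  have hg : (0 : ℝ) < Nat.gcd N (s N) := by
    exact_mod_cast Nat.gcd_pos_of_pos_left _ (Nat.pos_of_ne_zero hN0)
  have hlog := log_le_logSmoothPart hN0 (Nat.gcd_dvd_left N (s N)) fun p hp hpg =>
    le_of_prime_dvd_gcd hs hpos hprime hC hpow hN0 hDZ hsq hpair hp hpg
  set L := Real.log (Real.log x)
  -- `√L ≤ L - 1` for `L ≥ 4`. Passing to `√L` costs a factor `2` after taking logarithms, whence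
  -- the `M / 2` in `hsmooth`.
  have hNL : √L ≤ Real.log (Real.log N) := by
    refine le_trans ?_ (log_log_sub_one_le_of_sqrt_lt hx hN)
    rw [Real.sqrt_le_left (by linarith)]
    nlinarith
  have hL1 : 0 < Real.log (Real.log N) := (Real.sqrt_pos.2 (by linarith)).trans_le hNL
  have h1 : Real.log L / 2 ≤ Real.log (Real.log (Real.log N)) := by
    rw [← Real.log_sqrt (by linarith)]
    exact Real.log_le_log (Real.sqrt_pos.2 (by linarith)) hNL
  have h2 : 0 ≤ Real.log L := Real.log_nonneg (by linarith)
  rw [← Real.log_le_log_iff hg (Real.rpow_pos_of_pos hL1 _), Real.log_rpow hL1]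
  calc _ ≤ M / 2 * Real.log L := hlog.trans hsmooth
    _ = M * (Real.log L / 2) := by ring
    _ ≤ f N * (Real.log L / 2) := by gcongr
    _ ≤ _ := by gcongr; exact hM.trans hf

theorem tendsto_log_log_natCast :
    Tendsto (fun x : ℕ => Real.log (Real.log (x : ℝ))) atTop atTop :=
  Real.tendsto_log_atTop.comp (Real.tendsto_log_atTop.comp tendsto_natCast_atTop_atTop)

open Classical in
theorem hasDensityZero_setOf_rpow_lt_gcd {f : ℕ → ℝ} (hf : Tendsto f atTop atTop)
    {s : ArithmeticFunction ℕ} (hs : s.IsMultiplicative)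
    (hpos : ∀ n, 0 < n → 0 < s n) (hprime : ∀ p : ℕ, p.Prime → s p = p + 1) {C : ℝ} (hC : 0 ≤ C)
    (hpow : ∀ p e : ℕ, p.Prime → 1 ≤ e → (s (p ^ e) : ℝ) < (p : ℝ) ^ (C * (e : ℝ))) :
    HasDensityZero {N | Real.log (Real.log N) ^ f N < (Nat.gcd N (s N) : ℝ)} := by
  rw [HasDensityZero, Metric.tendsto_atTop']
  suffices H : ∀ ε : ℝ, 0 < ε → ∀ᶠ x : ℕ in atTop, ({n : ℕ | 1 ≤ n ∧ n ≤ x ∧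
      n ∈ {N : ℕ | Real.log (Real.log N) ^ f N < (Nat.gcd N (s N) : ℝ)}}.ncard : ℝ)
      ≤ ε * x by
    intro ε hε
    obtain ⟨X, hX⟩ := eventually_atTop.1 (H (ε / 2) (by positivity))
    refine ⟨X, fun x hx => ?_⟩
    have hx0 : (0 : ℝ) < x := by exact_mod_cast (Nat.zero_le X).trans_lt hx
    rw [Real.dist_eq, sub_zero, abs_of_nonneg (by positivity), div_lt_iff₀ hx0]
    exact (hX x hx.le).trans_lt (by nlinarith)
  intro ε hε
  -- Four exceptional sets are each allowed `ε x / 4`: `8 / ε` serves the square divisors, `160 / ε`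
  -- the smooth part, `128 / (log 2 * ε)` the pairs and `(4 / ε) ^ 2` the `N ≤ √x`.
  obtain ⟨D, hD⟩ := exists_nat_gt (8 / ε)
  have hD0 : (0 : ℝ) < D := lt_trans (by positivity) hD
  obtain ⟨N₀, hN₀⟩ := eventually_atTop.1 (hf.eventually_ge_atTop (160 / ε))
  have hlog2 : 0 < Real.log 2 := Real.log_pos (by norm_num)
  filter_upwards [eventually_ge_atTop (max 3 (N₀ ^ 2)),
    tendsto_log_log_natCast.eventually_ge_atTop 4,
    tendsto_log_log_natCast.eventually_ge_atTop (((D : ℝ) ^ 3) ^ C),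
    tendsto_log_log_natCast.eventually_ge_atTop (128 / (Real.log 2 * ε)),
    tendsto_natCast_atTop_atTop.eventually_ge_atTop ((4 / ε) ^ 2)] with x hx hL hLD hLε hxε
  have hx3 : 3 ≤ x := (le_max_left _ _).trans hx
  have hxN : N₀ ≤ Nat.sqrt x := Nat.le_sqrt'.2 ((le_max_right _ _).trans hx)
  have hx0 : (0 : ℝ) < x := by exact_mod_cast (by omega : 0 < x)
  set L := Real.log (Real.log x) with hLdef
  -- The fourth power gives `√Z ≥ L ^ 2`, which beats the factor `L` in the count of pairs, while
  -- `log Z` stays `O(log L)`.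
  set Z := ⌈L⌉₊ ^ 4 with hZ
  have hceil : L ≤ ⌈L⌉₊ := Nat.le_ceil L
  have hLZ : L ≤ Z := by
    rw [hZ, Nat.cast_pow]
    exact hceil.trans (le_self_pow₀ (by linarith) (by norm_num))
  have hZ4 : 4 ≤ Z := by exact_mod_cast hL.trans hLZ
  have hlogL : 0 < Real.log L := Real.log_pos (by linarith)
  set B := (Finset.Icc 1 x).filter fun N : ℕ =>
    Real.log (Real.log N) ^ f N < (Nat.gcd N (s N) : ℝ)
  have hset : {n : ℕ | 1 ≤ n ∧ n ≤ x ∧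
      Real.log (Real.log n) ^ f n < (Nat.gcd n (s n) : ℝ)} = (B : Set ℕ) := by
    ext n
    simp [B, and_assoc]
  rw [hset, Set.ncard_coe_finset]
  set t := 160 / ε / 2 * Real.log L
  have ht : 0 < t := by positivity
  set S₁ := Finset.Icc 1 (Nat.sqrt x)
  set S₂ := (Finset.Icc 1 x).filter fun N => ∃ d, D < d ∧ d ^ 2 ∣ N
  set S₃ := (Finset.Icc 1 x).filter (HasLargeNegOnePair Z)
  set S₄ := (Finset.Icc 1 x).filter fun N => t < logSmoothPart Z N
  have hsub : B ⊆ S₁ ∪ S₂ ∪ S₃ ∪ S₄ := by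
    intro N hN
    obtain ⟨hNx, hN⟩ := Finset.mem_filter.1 hN
    by_contra hcon
    simp only [S₁, S₂, S₃, S₄, Finset.mem_union, Finset.mem_filter, hNx, true_and, not_or] at hcon
    obtain ⟨⟨⟨h1, h2⟩, h3⟩, h4⟩ := hcon
    have hsqrt : Nat.sqrt x < N := by
      by_contra! h
      exact h1 (Finset.mem_Icc.2 ⟨(Finset.mem_Icc.1 hNx).1, h⟩)
    exact hN.not_ge (gcd_le_rpow_of_regular hs hpos hprime hC hpow (by positivity) hx3 hL hsqrt
      (hN₀ N (hxN.trans hsqrt.le)) (hLD.trans hLZ) h2 h3 (not_lt.1 h4))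
  have hcard : (B.card : ℝ) ≤ S₁.card + S₂.card + S₃.card + S₄.card := by
    refine (Nat.cast_le.2 (Finset.card_le_card hsub)).trans ?_
    have h1 := Finset.card_union_le (S₁ ∪ S₂ ∪ S₃) S₄
    have h2 := Finset.card_union_le (S₁ ∪ S₂) S₃
    have h3 := Finset.card_union_le S₁ S₂
    exact_mod_cast (by omega :
      (S₁ ∪ S₂ ∪ S₃ ∪ S₄).card ≤ S₁.card + S₂.card + S₃.card + S₄.card)
  have b1 : (S₁.card : ℝ) ≤ ε / 4 * x := by
    have h1 : (S₁.card : ℝ) ≤ √x := by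
      simp only [S₁, Nat.card_Icc, Nat.add_sub_cancel]
      exact Real.nat_sqrt_le_real_sqrt
    have h2 : 4 / ε ≤ √x := Real.le_sqrt_of_sq_le hxε
    rw [div_le_iff₀ hε] at h2
    have h3 := Real.mul_self_sqrt hx0.le
    nlinarith [Real.sqrt_nonneg (x : ℝ)]
  have b2 : (S₂.card : ℝ) ≤ ε / 4 * x := by
    refine (card_sq_dvd_le (by exact_mod_cast hD0) x).trans ?_
    rw [mul_comm]
    refine mul_le_mul_of_nonneg_right ?_ hx0.le
    rw [div_lt_iff₀ hε] at hD
    rw [div_le_iff₀ hD0]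
    linarith
  have b3 : (S₃.card : ℝ) ≤ ε / 4 * x := by
    refine (card_hasLargeNegOnePair_le hZ4 (Nat.le_pow_clog one_lt_two x)).trans ?_
    rw [mul_comm]
    refine mul_le_mul_of_nonneg_right ?_ hx0.le
    have hsqrtZ : L ^ 2 ≤ √Z := by
      refine Real.le_sqrt_of_sq_le ?_
      rw [hZ, Nat.cast_pow, ← pow_mul]
      gcongr
    have hlog := log_clog_two_le hx3
    calc 16 / Real.log 2 * (1 + Real.log (Nat.clog 2 x)) / √Z
        ≤ 16 / Real.log 2 * (2 * L) / L ^ 2 := by gcongr; linarith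
      _ = 32 / Real.log 2 / L := by field_simp; norm_num
      _ ≤ _ := by
          rw [div_le_iff₀ (by linarith), div_le_iff₀ hlog2]
          rw [div_le_iff₀ (by positivity)] at hLε
          linarith
  have b4 : (S₄.card : ℝ) ≤ ε / 4 * x := by
    refine (card_lt_logSmoothPart_le (by omega) x ht).trans ?_
    rw [div_le_iff₀ ht]
    have h := log_ceil_pow_four_add_log_four_le (by linarith : 2 ≤ L)
    calc _ ≤ (x : ℝ) * (2 * (10 * Real.log L)) := by gcongr
      _ = _ := by simp only [t]; field_simp; norm_num
  linarith

theorem gcdBoundOutsideDensityZero_of_isMultiplicative {f : ℕ → ℝ} (hf : Tendsto f atTop atTop)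
    {s : ArithmeticFunction ℕ} (hs : s.IsMultiplicative)
    (hpos : ∀ n, 0 < n → 0 < s n) (hprime : ∀ p : ℕ, p.Prime → s p = p + 1)
    (hpow : ∃ C : ℝ, ∀ p e : ℕ, p.Prime → 1 ≤ e → (s (p ^ e) : ℝ) < (p : ℝ) ^ (C * (e : ℝ))) :
    GcdBoundOutsideDensityZero f s := by
  obtain ⟨C, hC⟩ := hpow
  -- A nonnegative exponent is needed for `y ↦ y ^ C` to be monotone, so `C` is enlarged to `max C
  -- 0`.
  refine ⟨_, hasDensityZero_setOf_rpow_lt_gcd hf hs hpos hprime (le_max_right C 0)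
    fun p e hp he => (hC p e hp he).trans_le ?_, fun N _ hN => not_lt.1 hN⟩
  refine Real.rpow_le_rpow_of_exponent_le (by exact_mod_cast hp.one_le) ?_
  gcongr
  exact le_max_left C 0

/-- Makes `C = 2` admissible for `σ`, because `e + 1 ≤ 2 e`. -/
theorem sigma_one_prime_pow_lt {p e : ℕ} (hp : p.Prime) (he : 1 ≤ e) :
    σ 1 (p ^ e) < p ^ (2 * e) := by
  rw [ArithmeticFunction.sigma_one_apply_prime_pow hp]
  calc _ < p ^ (e + 1) := Nat.geomSum_lt hp.two_le fun k hk => Finset.mem_range.1 hk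
    _ ≤ p ^ (2 * e) := Nat.pow_le_pow_right hp.pos (by omega)

theorem theorem1p1 (f : ℕ → ℝ) (hf : Tendsto f atTop atTop) :
    GcdBoundOutsideDensityZero f (σ 1) ∧
    ∀ s : ArithmeticFunction ℕ,
      s.IsMultiplicative →
      (∀ n : ℕ, 0 < n → 0 < s n) →
      (∀ p : ℕ, p.Prime → s p = p + 1) →
      (∃ C : ℝ, ∀ p e : ℕ, p.Prime → 1 ≤ e → (s (p ^ e) : ℝ) < (p : ℝ) ^ (C * (e : ℝ))) →
      GcdBoundOutsideDensityZero f s := by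
  refine ⟨gcdBoundOutsideDensityZero_of_isMultiplicative hf
    ArithmeticFunction.isMultiplicative_sigma (fun n hn => ?_) (fun p hp => ?_)
    ⟨2, fun p e hp he => ?_⟩, fun s hs hpos hprime hpow =>
      gcdBoundOutsideDensityZero_of_isMultiplicative hf hs hpos hprime hpow⟩
  · exact ArithmeticFunction.sigma_pos 1 n hn.ne'
  · have := ArithmeticFunction.sigma_one_apply_prime_pow (i := 1) hp
    rw [pow_one] at this
    rw [this, Finset.sum_range_succ, Finset.sum_range_one]
    ring
  · have h := sigma_one_prime_pow_lt hp he
    rw [show (2 : ℝ) * e = ((2 * e : ℕ) : ℝ) by push_cast; ring, Real.rpow_natCast]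
    exact_mod_cast h
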